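/- All $C^*$-algebras are complex, and need be neither unital nor separable unless stated. A $C^*$-algebra $A$ is *nuclear* if it has the completely positive approximation property: for every finite subset $X\subseteq A$ and every $\epsilon>0$ there are $n\in\mathbb{N}$ and contractive completely positive maps $\psi:A\to M_n(\mathbb{C})$ and $\phi:M_n(\mathbb{C})\to A$ such that $\|\phi(\psi(x))-x\|<\epsilon$ for all $x\in X$. For a subset $S$ of a $C^*$-algebra write $x\in_\epsilon S$ if there is $s\in S$ with $\|x-s\|<\epsilon$. Let $\mathcal{C}$ be a class of $C^*$-algebras. A unital $C^*$-algebra $A$ *decomposes over $\mathcal{C}$* if for every finite subset $X$ of the (closed) unit ball of $A$ and every $\epsilon>0$ there are $C^*$-subalgebras $C$, $D$, $E$ of $A$ (not required to contain $1_A$), all in the class $\mathcal{C}$, and a positive contraction $h\in E$ such that 1. $\|hx-xh\|<\epsilon$ for all $x\in X$; 2. $hx\in_\epsilon C$, $(1-h)x\in_\epsilon D$ and $h(1-h)x\in_\epsilon E$ for all $x\in X$; 3. $e\in_\epsilon C$ and $e\in_\epsilon D$ for all $e$ in the unit ball of $E$. A non-unital $C^*$-algebra *decomposes over $\mathcal{C}$*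 if its unitization does. The class $\mathcal{C}$ is *closed under decomposability* if every $C^*$-algebra that decomposes over $\mathcal{C}$ belongs to $\mathcal{C}$. **Statement.** The class of nuclear $C^*$-algebras is closed under decomposability. -/

import Mathlib

universe u

namespace CStarDecomposition

open scoped CStarAlgebra ComplexOrder

/-- A (not necessarily unital, not necessarily separable) C*-algebra `A` is nuclear if its
identity map is a point-norm limit of maps that factor, through contractive completely positive
maps, over full matrix algebras `M_n(ℂ)`.  Positivity in `A` is with respect to the canonical
(spectral) order of the C*-algebra. -/
def IsNuclear (A : Type u) [NonUnitalCStarAlgebra A] : Prop :=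
  letI : PartialOrder A := CStarAlgebra.spectralOrder A
  haveI : StarOrderedRing A := CStarAlgebra.spectralOrderedRing A
  ∀ (X : Finset A) (ε : ℝ), 0 < ε →
    ∃ (n : ℕ) (ψ : A →CP CStarMatrix (Fin n) (Fin n) ℂ)
      (φ : CStarMatrix (Fin n) (Fin n) ℂ →CP A),
      (∀ a : A, ‖ψ a‖ ≤ ‖a‖) ∧
      (∀ m : CStarMatrix (Fin n) (Fin n) ℂ, ‖φ m‖ ≤ ‖m‖) ∧
      ∀ x ∈ X, ‖φ (ψ x) - x‖ < ε

/-- Positive elements of a C*-algebra. -/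
def IsPositive {A : Type u} [NonUnitalCStarAlgebra A] (a : A) : Prop :=
  letI : PartialOrder A := CStarAlgebra.spectralOrder A
  0 ≤ a

/-- `e` is a (necessarily unique) multiplicative identity of `A`. -/
def IsIdentity {A : Type u} [NonUnitalCStarAlgebra A] (e : A) : Prop :=
  ∀ a : A, e * a = a ∧ a * e = a

/-- `ApproxMem ε x S`: some element of `S` is at distance less than `ε` from `x`. -/
def ApproxMem {A : Type u} [NonUnitalCStarAlgebra A] (ε : ℝ) (x : A) (S : Set A) : Prop :=
  ∃ s ∈ S, ‖x - s‖ < ε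

/-- The C*-subalgebra of `A` with underlying star-subalgebra `S` (closed in norm, not required
to contain the identity of `A`) is in the class `𝒞`. -/
def SubalgebraInClass (𝒞 : ∀ (B : Type u) [NonUnitalCStarAlgebra B], Prop)
    {A : Type u} [NonUnitalCStarAlgebra A] (S : NonUnitalStarSubalgebra ℂ A) : Prop :=
  ∃ hS : IsClosed (S : Set A),
    letI : NonUnitalCStarAlgebra S :=
      NonUnitalStarSubalgebra.nonUnitalCStarAlgebra (h_closed := hS) S
    𝒞 S

/-- Decomposability over `𝒞` of a unital C*-algebra `A` whose identity is `e`. -/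
def DecomposesWithIdentity (𝒞 : ∀ (B : Type u) [NonUnitalCStarAlgebra B], Prop)
    (A : Type u) [NonUnitalCStarAlgebra A] (e : A) : Prop :=
  ∀ X : Finset A, (∀ x ∈ X, ‖x‖ ≤ 1) → ∀ ε : ℝ, 0 < ε →
    ∃ C D E : NonUnitalStarSubalgebra ℂ A,
      SubalgebraInClass 𝒞 C ∧ SubalgebraInClass 𝒞 D ∧ SubalgebraInClass 𝒞 E ∧
      ∃ h ∈ E, IsPositive h ∧ ‖h‖ ≤ 1 ∧
        (∀ x ∈ X, ‖h * x - x * h‖ < ε) ∧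
        (∀ x ∈ X, ApproxMem ε (h * x) C ∧ ApproxMem ε ((e - h) * x) D ∧
          ApproxMem ε (h * (e - h) * x) E) ∧
        (∀ y ∈ E, ‖y‖ ≤ 1 → ApproxMem ε y C ∧ ApproxMem ε y D)

/-- A C*-algebra decomposes over `𝒞` if it is unital and the condition above holds for its
identity, or it is not unital and the condition above holds for its unitization. -/
def DecomposesOver (𝒞 : ∀ (B : Type u) [NonUnitalCStarAlgebra B], Prop)
    (A : Type u) [NonUnitalCStarAlgebra A] : Prop :=
  (∃ e : A, IsIdentity e ∧ DecomposesWithIdentity 𝒞 A e) ∨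
  ((¬ ∃ e : A, IsIdentity e) ∧ DecomposesWithIdentity 𝒞 (Unitization ℂ A) 1)

/-- A class of C*-algebras is closed under decomposability if it contains every C*-algebra
that decomposes over it. -/
def ClosedUnderDecomposability (𝒞 : ∀ (B : Type u) [NonUnitalCStarAlgebra B], Prop) : Prop :=
  ∀ (A : Type u) [NonUnitalCStarAlgebra A], DecomposesOver 𝒞 A → 𝒞 A

end CStarDecomposition

namespace CStarDecomposition

open scoped CStarAlgebra ComplexOrder

/-! Let A be unital and take `h`, C, D from the decomposition. Since `h` lies in E, it is close to
both C and D, and it almost commutes with X. Hence `h * x * h` is close to C and `(1 - h) * x * (1 -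
h)` is close to D. Put `w = h + i(1 - h)`. Then `star w * x * w` is the sum of these two
compressions plus i times the commutator of `h` and `x`, so it is close to the sum. Moreover `star w
* w = h² + (1 - h)² ≥ 1/2`, so `w` is invertible with inverse of norm at most √2. Conjugating the
sum by that inverse recovers `x` up to a multiple of the tolerance.

The compressions are approximated through matrix algebras. By nuclearity, C and D carry approximate
factorizations. Their maps into matrices extend to A, up to compression by an approximate unit, by
an Arveson-type argument (`exists_cp_extension`) resting on the M. Riesz extension theorem. Sums of
factorable maps factor through block diagonals, so the identity of A is approximated by factorable
maps. Renormalizing at the unit makes both factors contractive (`isNuclear_of_matrixFactorable`).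

For non-unital A, nuclearity descends from the unitization to the ideal A, by compressing with an
approximate unit. -/

/-- An algebraic form of complete positivity: for every finite family `a`, the matrix with entries
`f (star (a i) * a j)` is a finite sum of matrices of the form `star (b i) * b j`. -/
def IsCP {A B : Type*} [NonUnitalCStarAlgebra A] [NonUnitalCStarAlgebra B] (f : A →ₗ[ℂ] B) : Prop :=
  ∀ (k : ℕ) (a : Fin k → A), ∃ (s : Type) (_ : Fintype s) (r : s → Fin k → B),
    ∀ i j, f (star (a i) * a j) = ∑ l, star (r l i) * r l j

theorem nonneg_iff_exists_star_mul_self {A : Type*} [NonUnitalCStarAlgebra A] [PartialOrder A]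
    [StarOrderedRing A] {a : A} : 0 ≤ a ↔ ∃ b, a = star b * b :=
  CStarAlgebra.nonneg_iff_eq_star_mul_self

/-! ### Calculus of completely positive maps in Gram form. -/

section Basic

variable {A B D : Type*} [NonUnitalCStarAlgebra A] [NonUnitalCStarAlgebra B]
  [NonUnitalCStarAlgebra D]

theorem IsCP.comp {g : B →ₗ[ℂ] D} {f : A →ₗ[ℂ] B} (hg : IsCP g) (hf : IsCP f) :
    IsCP (g ∘ₗ f) := by
  intro k a
  obtain ⟨s, _, r, hr⟩ := hf k a
  choose t ht q hq using fun l => hg k (r l)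
  refine ⟨Σ l, t l, inferInstance, fun p => q p.1 p.2, fun i j => ?_⟩
  simp [hr, hq, Fintype.sum_sigma]

theorem IsCP.add {f g : A →ₗ[ℂ] B} (hf : IsCP f) (hg : IsCP g) : IsCP (f + g) := by
  intro k a
  obtain ⟨s, _, r, hr⟩ := hf k a
  obtain ⟨t, _, q, hq⟩ := hg k a
  refine ⟨s ⊕ t, inferInstance, Sum.elim r q, fun i j => ?_⟩
  simp [hr, hq]

theorem isCP_of_starHom (f : A →⋆ₙₐ[ℂ] B) : IsCP (f : A →ₗ[ℂ] B) := by
  intro k a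
  exact ⟨Unit, inferInstance, fun _ i => f (a i), fun i j => by simp [map_star]⟩

/-- The map `x ↦ star c * x * c`. -/
def conjBy (c : A) : A →ₗ[ℂ] A where
  toFun x := star c * x * c
  map_add' x y := by rw [mul_add, add_mul]
  map_smul' z x := by simp [mul_smul_comm, smul_mul_assoc]

@[simp]
theorem conjBy_apply (c x : A) : conjBy c x = star c * x * c := rfl

theorem isCP_conjBy (c : A) : IsCP (conjBy c) := by
  intro k a
  exact ⟨Unit, inferInstance, fun _ i => a i * c, fun i j => by simp [mul_assoc]⟩

theorem norm_conjBy_apply_le (c x : A) : ‖conjBy c x‖ ≤ ‖c‖ ^ 2 * ‖x‖ := by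
  calc ‖star c * x * c‖ ≤ ‖star c‖ * ‖x‖ * ‖c‖ :=
        (norm_mul_le _ _).trans (by gcongr; exact norm_mul_le _ _)
    _ = ‖c‖ ^ 2 * ‖x‖ := by rw [norm_star]; ring

theorem IsCP.smul {f : A →ₗ[ℂ] B} (hf : IsCP f) {t : ℝ} (ht : 0 ≤ t) : IsCP ((t : ℂ) • f) := by
  intro k a
  obtain ⟨s, _, r, hr⟩ := hf k a
  refine ⟨s, inferInstance, fun l i => ((Real.sqrt t : ℝ) : ℂ) • r l i, fun i j => ?_⟩
  have h : ((Real.sqrt t : ℝ) : ℂ) * ((Real.sqrt t : ℝ) : ℂ) = t := by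
    rw [← Complex.ofReal_mul, Real.mul_self_sqrt ht]
  rw [LinearMap.smul_apply, hr, Finset.smul_sum]
  refine Finset.sum_congr rfl fun l _ => ?_
  rw [star_smul, smul_mul_smul_comm, Complex.star_def, Complex.conj_ofReal, h]

theorem IsCP.exists_star_mul_self {f : A →ₗ[ℂ] B} (hf : IsCP f) (a : A) :
    ∃ (s : Type) (_ : Fintype s) (r : s → B), f (star a * a) = ∑ l, star (r l) * r l := by
  obtain ⟨s, _, r, hr⟩ := hf 1 fun _ => a
  exact ⟨s, inferInstance, fun l => r l 0, hr 0 0⟩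

theorem IsCP.map_nonneg [PartialOrder A] [StarOrderedRing A] [PartialOrder B] [StarOrderedRing B]
    {f : A →ₗ[ℂ] B} (hf : IsCP f) {a : A} (ha : 0 ≤ a) : 0 ≤ f a := by
  obtain ⟨b, rfl⟩ := nonneg_iff_exists_star_mul_self.mp ha
  obtain ⟨s, _, r, hr⟩ := hf.exists_star_mul_self b
  rw [hr]
  exact Finset.sum_nonneg fun l _ => star_mul_self_nonneg _

end Basic

section RowMatrix

variable {A : Type*} [NonUnitalRing A] {n : Type*} [DecidableEq n]

/-- The square matrix whose row `i₀` is `v` and whose other rows vanish. -/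
def rowMatrix (i₀ : n) (v : n → A) : CStarMatrix n n A :=
  CStarMatrix.ofMatrix fun i j => if i = i₀ then v j else 0

@[simp]
theorem rowMatrix_apply (i₀ : n) (v : n → A) (i j : n) :
    rowMatrix i₀ v i j = if i = i₀ then v j else 0 := rfl

theorem star_rowMatrix_mul_apply [StarRing A] [Fintype n] (i₀ : n) (v w : n → A) (i j : n) :
    (star (rowMatrix i₀ v) * rowMatrix i₀ w) i j = star (v i) * w j := by
  simp [CStarMatrix.mul_apply, CStarMatrix.star_apply]

end RowMatrix

theorem cstarMatrix_sum_apply {A m n s : Type*} [AddCommMonoid A] (t : Finset s)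
    (M : s → CStarMatrix m n A) (i : m) (j : n) : (∑ l ∈ t, M l) i j = ∑ l ∈ t, M l i j := by
  classical
  induction t using Finset.induction_on with
  | empty => simp
  | insert a t ha ih => simp [Finset.sum_insert ha, ih]

section CompletelyPositive

variable {A B : Type*} [NonUnitalCStarAlgebra A] [NonUnitalCStarAlgebra B]
  [PartialOrder A] [StarOrderedRing A] [PartialOrder B] [StarOrderedRing B]

/-- A positive matrix `star q * q` is the sum over the rows of `q` of Gram matrices `star (q p i) *
q p j`, and `IsCP` treats each row separately. -/
theorem IsCP.map_cstarMatrix_nonneg {f : A →ₗ[ℂ] B} (hf : IsCP f) (k : ℕ)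
    (M : CStarMatrix (Fin k) (Fin k) A) (hM : 0 ≤ M) : 0 ≤ M.map f := by
  obtain ⟨q, rfl⟩ := nonneg_iff_exists_star_mul_self.mp hM
  choose s hs r hr using fun p => hf k (q p)
  have h : (star q * q).map f =
      ∑ p, ∑ l, star (rowMatrix p (r p l)) * rowMatrix p (r p l) := by
    ext i j
    simp_rw [cstarMatrix_sum_apply, star_rowMatrix_mul_apply]
    simp [CStarMatrix.mul_apply, CStarMatrix.star_apply, hr]
  rw [h]
  exact Finset.sum_nonneg fun p _ => Finset.sum_nonneg fun l _ => star_mul_self_nonneg _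

/-- A Gram matrix of `a` is `star R * R` with `a` as the only nonzero row of R; the rows of a
square-root factor of its image are the required families. -/
theorem isCP_of_map_cstarMatrix_nonneg {f : A →ₗ[ℂ] B}
    (hf : ∀ (k : ℕ) (M : CStarMatrix (Fin k) (Fin k) A), 0 ≤ M → 0 ≤ M.map f) : IsCP f := by
  intro k a
  obtain _ | k := k
  · exact ⟨Empty, inferInstance, fun l => l.elim, fun i => i.elim0⟩
  have h := hf (k + 1) _ (star_mul_self_nonneg (rowMatrix 0 a))
  obtain ⟨r, hr⟩ := nonneg_iff_exists_star_mul_self.mp h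
  refine ⟨Fin (k + 1), inferInstance, r, fun i j => ?_⟩
  have := CStarMatrix.ext_iff.mpr hr i j
  rw [CStarMatrix.map_apply, star_rowMatrix_mul_apply] at this
  simpa [CStarMatrix.mul_apply, CStarMatrix.star_apply] using this

theorem isCP_toLinearMap (f : A →CP B) : IsCP f.toLinearMap :=
  isCP_of_map_cstarMatrix_nonneg f.map_cstarMatrix_nonneg'

end CompletelyPositive

theorem isNuclear_iff (A : Type u) [NonUnitalCStarAlgebra A] :
    IsNuclear A ↔ ∀ (X : Finset A) (ε : ℝ), 0 < ε →
      ∃ (n : ℕ) (ψ : A →ₗ[ℂ] CStarMatrix (Fin n) (Fin n) ℂ)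
        (φ : CStarMatrix (Fin n) (Fin n) ℂ →ₗ[ℂ] A), IsCP ψ ∧ IsCP φ ∧
        (∀ a, ‖ψ a‖ ≤ ‖a‖) ∧ (∀ m, ‖φ m‖ ≤ ‖m‖) ∧ ∀ x ∈ X, ‖φ (ψ x) - x‖ < ε := by
  let _ : PartialOrder A := CStarAlgebra.spectralOrder A
  have : StarOrderedRing A := CStarAlgebra.spectralOrderedRing A
  constructor
  · intro h X ε hε
    obtain ⟨n, ψ, φ, h1, h2, h3⟩ := h X ε hε
    exact ⟨n, ψ.toLinearMap, φ.toLinearMap, isCP_toLinearMap ψ, isCP_toLinearMap φ, h1, h2, h3⟩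
  · intro h X ε hε
    obtain ⟨n, ψ, φ, hψ, hφ, h1, h2, h3⟩ := h X ε hε
    exact ⟨n, ⟨ψ, hψ.map_cstarMatrix_nonneg⟩, ⟨φ, hφ.map_cstarMatrix_nonneg⟩, h1, h2, h3⟩

/-! ### Cauchy–Schwarz and the norm of a completely positive map. -/

section CauchySchwarz

theorem norm_sum_star_mul_sq_le {B s : Type*} [NonUnitalCStarAlgebra B] [Fintype s]
    (x y : s → B) :
    ‖∑ l, star (x l) * y l‖ ^ 2 ≤ ‖∑ l, star (x l) * x l‖ * ‖∑ l, star (y l) * y l‖ := by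
  let _ : PartialOrder B := CStarAlgebra.spectralOrder B
  have : StarOrderedRing B := CStarAlgebra.spectralOrderedRing B
  let v : WithCStarModule B (s → B) := (WithCStarModule.equiv _ _).symm fun l => star (y l)
  let w : WithCStarModule B (s → B) := (WithCStarModule.equiv _ _).symm fun l => star (x l)
  have h := CStarModule.norm_inner_le (A := B) (WithCStarModule B (s → B)) (x := v) (y := w)
  rw [WithCStarModule.pi_inner, WithCStarModule.pi_norm, WithCStarModule.pi_norm] at h
  simp only [WithCStarModule.inner_def, v, w, WithCStarModule.equiv_symm_pi_apply, star_star] at h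
  calc _ ≤ (√‖∑ l, star (y l) * y l‖ * √‖∑ l, star (x l) * x l‖) ^ 2 := by gcongr
    _ = _ := by
      rw [mul_pow, Real.sq_sqrt (norm_nonneg _), Real.sq_sqrt (norm_nonneg _), mul_comm]

/-- Cauchy–Schwarz for the family `1, a` bounds `‖f a‖²` by `‖f 1‖ * ‖f (star a * a)‖`, and `star a
* a ≤ ‖a‖²` bounds the last factor. -/
theorem IsCP.norm_apply_le {A B : Type*} [CStarAlgebra A] [NonUnitalCStarAlgebra B]
    {f : A →ₗ[ℂ] B} (hf : IsCP f) (a : A) : ‖f a‖ ≤ ‖f 1‖ * ‖a‖ := by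
  let _ : PartialOrder A := CStarAlgebra.spectralOrder A
  have : StarOrderedRing A := CStarAlgebra.spectralOrderedRing A
  let _ : PartialOrder B := CStarAlgebra.spectralOrder B
  have : StarOrderedRing B := CStarAlgebra.spectralOrderedRing B
  have h1 : ‖f a‖ ^ 2 ≤ ‖f 1‖ * ‖f (star a * a)‖ := by
    obtain ⟨s, _, r, hr⟩ := hf 2 ![1, a]
    have h := norm_sum_star_mul_sq_le (fun l => r l 0) (fun l => r l 1)
    simpa [← hr] using h
  have h2 : ‖f (star a * a)‖ ≤ ‖f 1‖ * ‖a‖ ^ 2 := by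
    have h3 : 0 ≤ f (star a * a) := hf.map_nonneg (star_mul_self_nonneg a)
    have h4 : 0 ≤ f (((‖a‖ ^ 2 : ℝ) : ℂ) • 1 - star a * a) := by
      refine hf.map_nonneg (sub_nonneg.mpr ?_)
      have := CStarAlgebra.star_mul_le_algebraMap_norm_sq (a := a)
      rwa [Algebra.algebraMap_eq_smul_one, ← Complex.coe_smul] at this
    rw [map_sub, sub_nonneg, map_smul] at h4
    have := CStarAlgebra.norm_le_norm_of_nonneg_of_le h3 h4
    rw [norm_smul, Complex.norm_real, Real.norm_of_nonneg (by positivity)] at this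
    linarith
  refine le_of_sq_le_sq ?_ (by positivity)
  calc _ ≤ _ := h1
    _ ≤ ‖f 1‖ * (‖f 1‖ * ‖a‖ ^ 2) := by gcongr
    _ = _ := by ring

end CauchySchwarz

/-! ### Extending positive functionals. -/

section Extension

/-- Injective star homomorphisms are isometric and commute with functional calculus, hence reflect
vanishing of the negative part. -/
theorem nonneg_of_map_nonneg {A B : Type*} [NonUnitalCStarAlgebra A] [NonUnitalCStarAlgebra B]
    [PartialOrder A] [StarOrderedRing A] [PartialOrder B] [StarOrderedRing B]
    (ι : B →⋆ₙₐ[ℂ] A) (hι : Function.Injective ι) {b : B} (hb : 0 ≤ ι b) : 0 ≤ b := by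
  have hsa : IsSelfAdjoint b := by
    apply hι
    rw [map_star]
    exact hb.isSelfAdjoint
  have hsa' : IsSelfAdjoint (ι b) := hb.isSelfAdjoint
  rw [← CFC.negPart_eq_zero_iff b hsa]
  apply hι
  rw [map_zero, ← (CFC.negPart_eq_zero_iff (ι b) hsa').mpr hb, CFC.negPart_def, CFC.negPart_def]
  exact NonUnitalStarAlgHomClass.map_cfcₙ ι _ b (by fun_prop) (by simp)
    (NonUnitalStarAlgHom.isometry ι hι).continuous hsa hsa'

theorem map_star_of_nonneg {B : Type*} [NonUnitalCStarAlgebra B] (F : B →ₗ[ℂ] ℂ)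
    (hF : ∀ b, 0 ≤ F (star b * b)) (b : B) : F (star b) = star (F b) := by
  let _ : PartialOrder B := CStarAlgebra.spectralOrder B
  have : StarOrderedRing B := CStarAlgebra.spectralOrderedRing B
  let P : B →ₚ[ℂ] ℂ := PositiveLinearMap.mk₀ F fun x hx => by
    obtain ⟨b, rfl⟩ := nonneg_iff_exists_star_mul_self.mp hx
    exact hF b
  exact map_star P b

/-- A positive functional on a C⋆-subalgebra, cut down by an element `v` of the subalgebra, extends
to a positive functional on the ambient unital C⋆-algebra. -/
theorem exists_positive_extension {A B : Type*} [CStarAlgebra A] [NonUnitalCStarAlgebra B]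
    (ι : B →⋆ₙₐ[ℂ] A) (hι : Function.Injective ι) (F : B →ₗ[ℂ] ℂ)
    (hF : ∀ b, 0 ≤ F (star b * b)) (v : B) :
    ∃ G : A →ₗ[ℂ] ℂ, (∀ a, 0 ≤ G (star a * a)) ∧
      ∀ x y, ι y = star (ι v) * x * ι v → G x = F y := by
  let _ : PartialOrder A := CStarAlgebra.spectralOrder A
  have : StarOrderedRing A := CStarAlgebra.spectralOrderedRing A
  let _ : PartialOrder B := CStarAlgebra.spectralOrder B
  have : StarOrderedRing B := CStarAlgebra.spectralOrderedRing B
  -- Working with nonnegative real part on all of A, rather than with self-adjoint elements, lets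
  -- the real Riesz theorem apply directly.
  let S : PointedCone ℝ A :=
    { carrier := {x | 0 ≤ x + star x}
      zero_mem' := by simp
      add_mem' := fun {x y} hx hy => by
        simp only [Set.mem_ofPred_eq] at hx hy ⊢
        rw [star_add, add_add_add_comm]
        exact add_nonneg hx hy
      smul_mem' := fun c x hx => by
        simp only [Set.mem_ofPred_eq] at hx ⊢
        have : c • x + star (c • x) = (c : ℝ) • (x + star x) := by
          rw [smul_add, show c • x = (c : ℝ) • x from rfl, star_smul, star_trivial]
        rw [this]
        exact smul_nonneg c.2 hx }
  -- The cut-down by `v` is what puts the real scalars in the domain, since `star v * v` lies in B;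
  -- this supplies the order unit that B itself may lack.
  let dom : Submodule ℝ A := ((LinearMap.range (ι : B →ₗ[ℂ] A)).comap
    (conjBy (ι v))).restrictScalars ℝ
  have hdom (x : A) : x ∈ dom ↔ ∃ y, ι y = star (ι v) * x * ι v := by
    simp [dom]
  choose Y hY using fun x : dom => (hdom x).mp x.2
  have Yuniq (x : dom) (y : B) (h : ι y = star (ι v) * x * ι v) : Y x = y :=
    hι ((hY x).trans h.symm)
  let f : A →ₗ.[ℝ] ℝ :=
    { domain := dom
      toFun :=
        { toFun := fun x => (F (Y x)).re
          map_add' := fun x y => by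
            rw [Yuniq (x + y) (Y x + Y y) (by simp [hY, mul_add, add_mul])]
            simp
          map_smul' := fun c x => by
            rw [Yuniq (c • x) ((c : ℂ) • Y x) (by
              rw [map_smul, hY]; simp)]
            simp } }
  obtain ⟨g, hg1, hg2⟩ := riesz_extension S f (by
    intro x hx
    have hx' : 0 ≤ (x : A) + star (x : A) := hx
    have h1 : 0 ≤ Y x + star (Y x) := by
      refine nonneg_of_map_nonneg ι hι ?_
      have : ι (Y x + star (Y x)) = star (ι v) * (x + star (x : A)) * ι v := by
        rw [map_add, map_star, hY]
        simp [mul_add, add_mul, mul_assoc]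
      rw [this]
      exact star_left_conjugate_nonneg hx' _
    obtain ⟨b, hb⟩ := nonneg_iff_exists_star_mul_self.mp h1
    have h2 := hF b
    rw [← hb, map_add, map_star_of_nonneg F hF] at h2
    have h3 : 0 ≤ (F (Y x) + star (F (Y x))).re := (Complex.le_def.mp h2).1
    simp only [Complex.add_re, Complex.star_def, Complex.conj_re] at h3
    change 0 ≤ (F (Y x)).re
    linarith) (by
    intro y
    have h1 : (algebraMap ℝ A ‖y + star y‖) ∈ dom := by
      rw [hdom]
      refine ⟨((‖y + star y‖ : ℝ) : ℂ) • (star v * v), ?_⟩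
      rw [map_smul, map_mul, map_star, Algebra.algebraMap_eq_smul_one]
      simp
    refine ⟨⟨_, h1⟩, ?_⟩
    change 0 ≤ algebraMap ℝ A ‖y + star y‖ + y + star (algebraMap ℝ A ‖y + star y‖ + y)
    have h2 : -(y + star y) ≤ algebraMap ℝ A ‖y + star y‖ := by
      have := IsSelfAdjoint.le_algebraMap_norm_self (a := -(y + star y))
        (by rw [isSelfAdjoint_iff]; simp [add_comm])
      rwa [norm_neg] at this
    have h3 : 0 ≤ algebraMap ℝ A ‖y + star y‖ := algebraMap_nonneg _ (norm_nonneg _)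
    have h4 : star (algebraMap ℝ A ‖y + star y‖) = algebraMap ℝ A ‖y + star y‖ :=
      h3.isSelfAdjoint
    rw [star_add, h4]
    have h5 := add_nonneg (neg_le_iff_add_nonneg'.mp h2) h3
    convert h5 using 1
    abel)
  -- A skew-adjoint element and its negative both lie in the cone, so the complexification of `g` is
  -- real on self-adjoint elements.
  have hskew (x : A) (hx : star x = -x) : g x = 0 := by
    have h1 : x ∈ S := by change 0 ≤ x + star x; simp [hx]
    have h2 : -x ∈ S := by change 0 ≤ -x + star (-x); simp [hx]
    have h3 := hg2 x h1
    have h4 := hg2 _ h2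
    rw [map_neg] at h4
    linarith
  refine ⟨Module.Dual.extendRCLike g, fun a => ?_, fun x y hxy => ?_⟩
  · have h1 : g (Complex.I • (star a * a)) = 0 := hskew _ (by simp [star_smul])
    have h2 : star a * a ∈ S := by
      change 0 ≤ star a * a + star (star a * a)
      rw [star_mul, star_star]
      exact add_nonneg (star_mul_self_nonneg a) (star_mul_self_nonneg a)
    rw [Module.Dual.extendRCLike_apply, RCLike.I_to_complex, h1]
    simpa using hg2 _ h2
  · have key (x : A) (y : B) (hxy : ι y = star (ι v) * x * ι v) : g x = (F y).re := by
      have hx : x ∈ dom := (hdom x).mpr ⟨y, hxy⟩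
      rw [hg1 ⟨x, hx⟩, ← Yuniq ⟨x, hx⟩ y hxy]
      rfl
    rw [Module.Dual.extendRCLike_apply, RCLike.I_to_complex, key x y hxy,
      key (Complex.I • x) (Complex.I • y) (by simp [hxy])]
    apply Complex.ext <;> simp

end Extension

/-! ### Matrix-valued maps as functionals on matrices, and Arveson extension. -/

open scoped MatrixOrder Matrix.Norms.L2Operator in
theorem exists_gram_of_posSemidef {ι : Type*} [Fintype ι] [DecidableEq ι] (T : Matrix ι ι ℂ)
    (hT : ∀ i j, T j i = star (T i j)) (hpos : ∀ z : ι → ℂ, 0 ≤ ∑ i, ∑ j, star (z i) * T i j * z j) :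
    ∃ b : ι → ι → ℂ, ∀ i j, T i j = ∑ w, star (b w i) * b w j := by
  have h : T.PosSemidef := by
    refine Matrix.PosSemidef.of_dotProduct_mulVec_nonneg ?_ fun z => ?_
    · ext i j
      rw [Matrix.conjTranspose_apply, hT, star_star]
    · convert hpos z using 1
      simp [dotProduct, Matrix.mulVec, Finset.mul_sum, mul_assoc]
  obtain ⟨b, hb⟩ := CStarAlgebra.nonneg_iff_eq_star_mul_self.mp h.nonneg
  exact ⟨b, fun i j => by rw [hb]; simp [Matrix.mul_apply, Matrix.star_apply]⟩

/-- The matrix unit with entry `a` at position `(i, j)`. -/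
def single {A : Type*} [NonUnitalCStarAlgebra A] {n : ℕ} (i j : Fin n) :
    A →ₗ[ℂ] CStarMatrix (Fin n) (Fin n) A where
  toFun a := CStarMatrix.ofMatrix (Matrix.single i j a)
  map_add' a b := by rw [Matrix.single_add]; rfl
  map_smul' z a := by rw [← Matrix.smul_single]; rfl

theorem single_apply {A : Type*} [NonUnitalCStarAlgebra A] {n : ℕ} (i j : Fin n) (a : A)
    (p q : Fin n) : single i j a p q = if i = p ∧ j = q then a else 0 := rfl

/-- The linear map into matrices associated with a functional on matrices. -/
def ofFunctional {A : Type*} [NonUnitalCStarAlgebra A] {n : ℕ}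
    (G : CStarMatrix (Fin n) (Fin n) A →ₗ[ℂ] ℂ) : A →ₗ[ℂ] CStarMatrix (Fin n) (Fin n) ℂ where
  toFun a := CStarMatrix.ofMatrix fun i j => G (single i j a)
  map_add' a b := by ext; simp only [map_add]; rfl
  map_smul' z a := by ext; simp only [map_smul]; rfl

theorem ofFunctional_apply {A : Type*} [NonUnitalCStarAlgebra A] {n : ℕ}
    (G : CStarMatrix (Fin n) (Fin n) A →ₗ[ℂ] ℂ) (a : A) (i j : Fin n) :
    ofFunctional G a i j = G (single i j a) := rfl

/-- The scalar matrix `G (star (R p) * R q)` is positive semidefinite; a Gram factorization of it,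
with the index pair split into a family index and a matrix index, yields the required rows. -/
theorem isCP_ofFunctional {A : Type*} [NonUnitalCStarAlgebra A] {n : ℕ}
    (G : CStarMatrix (Fin n) (Fin n) A →ₗ[ℂ] ℂ) (hG : ∀ M, 0 ≤ G (star M * M)) :
    IsCP (ofFunctional G) := by
  let _ : PartialOrder A := CStarAlgebra.spectralOrder A
  have : StarOrderedRing A := CStarAlgebra.spectralOrderedRing A
  intro k a
  obtain _ | n := n
  · exact ⟨Empty, inferInstance, fun l => l.elim, fun i j => by ext p; exact p.elim0⟩
  let R (p : Fin k × Fin (n + 1)) : CStarMatrix (Fin (n + 1)) (Fin (n + 1)) A :=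
    single 0 p.2 (a p.1)
  have hR (p q : Fin k × Fin (n + 1)) :
      star (R p) * R q = single p.2 q.2 (star (a p.1) * a q.1) := by
    ext i j
    simp only [CStarMatrix.mul_apply, CStarMatrix.star_apply, R, single_apply]
    by_cases hi : p.2 = i <;> by_cases hj : q.2 = j <;> simp [hi, hj]
  obtain ⟨b, hb⟩ := exists_gram_of_posSemidef (fun p q => G (star (R p) * R q))
    (fun p q => by rw [← map_star_of_nonneg G hG, star_mul, star_star]) (fun z => by
      have := hG (∑ p, z p • R p)
      convert this using 1
      rw [star_sum, Finset.sum_mul_sum, map_sum]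
      refine Finset.sum_congr rfl fun p _ => ?_
      rw [map_sum]
      refine Finset.sum_congr rfl fun q _ => ?_
      rw [star_smul, smul_mul_smul_comm, map_smul, smul_eq_mul]
      ring)
  refine ⟨Fin k × Fin (n + 1), inferInstance, fun w p => rowMatrix 0 fun i => b w (p, i),
    fun p q => ?_⟩
  ext i j
  rw [cstarMatrix_sum_apply]
  simp_rw [star_rowMatrix_mul_apply]
  rw [ofFunctional_apply, ← hb (p, i) (q, j), hR]

/-- The functional on matrices associated with a linear map into matrices. -/
def toFunctional {B : Type*} [NonUnitalCStarAlgebra B] {n : ℕ}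
    (ψ : B →ₗ[ℂ] CStarMatrix (Fin n) (Fin n) ℂ) : CStarMatrix (Fin n) (Fin n) B →ₗ[ℂ] ℂ where
  toFun M := ∑ i, ∑ j, ψ (M i j) i j
  map_add' a b := by simp [Finset.sum_add_distrib]
  map_smul' z a := by simp [Finset.mul_sum]

theorem toFunctional_apply {B : Type*} [NonUnitalCStarAlgebra B] {n : ℕ}
    (ψ : B →ₗ[ℂ] CStarMatrix (Fin n) (Fin n) ℂ) (M : CStarMatrix (Fin n) (Fin n) B) :
    toFunctional ψ M = ∑ i, ∑ j, ψ (M i j) i j := rfl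

theorem toFunctional_single {B : Type*} [NonUnitalCStarAlgebra B] {n : ℕ}
    (ψ : B →ₗ[ℂ] CStarMatrix (Fin n) (Fin n) ℂ) (i j : Fin n) (b : B) :
    toFunctional ψ (single i j b) = ψ b i j := by
  rw [toFunctional_apply, Finset.sum_eq_single i, Finset.sum_eq_single j]
  · simp [single_apply]
  · intro q _ hq
    simp [single_apply, hq.symm]
  · simp
  · intro p _ hp
    simp [single_apply, hp.symm]
  · simp

theorem sum_sum_sum_rotate {ι κ s M : Type*} [Fintype ι] [Fintype κ] [Fintype s]
    [AddCommMonoid M] (f : ι → κ → s → M) :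
    ∑ i, ∑ j, ∑ l, f i j l = ∑ l, ∑ i, ∑ j, f i j l := by
  rw [Finset.sum_comm (s := (Finset.univ : Finset s))]
  exact Finset.sum_congr rfl fun i _ => Finset.sum_comm

/-- Expanding with the Gram form of `ψ` on each row of M turns the value into a sum of squared
moduli. -/
theorem toFunctional_nonneg {B : Type*} [NonUnitalCStarAlgebra B] {n : ℕ}
    {ψ : B →ₗ[ℂ] CStarMatrix (Fin n) (Fin n) ℂ} (hψ : IsCP ψ)
    (M : CStarMatrix (Fin n) (Fin n) B) : 0 ≤ toFunctional ψ (star M * M) := by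
  choose s hs r hr using fun p => hψ n (M p)
  have h : toFunctional ψ (star M * M) =
      ∑ p, ∑ l, ∑ m, star (∑ i, r p l i m i) * ∑ j, r p l j m j := by
    have h1 (i j : Fin n) : ψ ((star M * M) i j) i j =
        ∑ p, ∑ l, ∑ m, star (r p l i m i) * r p l j m j := by
      rw [CStarMatrix.mul_apply, map_sum, cstarMatrix_sum_apply]
      refine Finset.sum_congr rfl fun p _ => ?_
      rw [CStarMatrix.star_apply, hr, cstarMatrix_sum_apply]
      simp [CStarMatrix.mul_apply, CStarMatrix.star_apply]
    simp_rw [toFunctional_apply, h1, star_sum, Finset.sum_mul_sum]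
    rw [sum_sum_sum_rotate]
    refine Finset.sum_congr rfl fun p _ => ?_
    rw [sum_sum_sum_rotate]
    refine Finset.sum_congr rfl fun l _ => ?_
    rw [sum_sum_sum_rotate]
  rw [h]
  exact Finset.sum_nonneg fun p _ => Finset.sum_nonneg fun l _ => Finset.sum_nonneg fun m _ =>
    star_mul_self_nonneg _

/-- The diagonal matrix with all diagonal entries equal to `v`. -/
def scalarMatrix {A : Type*} [NonUnitalCStarAlgebra A] (n : ℕ) (v : A) :
    CStarMatrix (Fin n) (Fin n) A :=
  CStarMatrix.ofMatrix (Matrix.diagonal fun _ => v)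

theorem scalarMatrix_apply {A : Type*} [NonUnitalCStarAlgebra A] (n : ℕ) (v : A) (p q : Fin n) :
    scalarMatrix n v p q = if p = q then v else 0 := rfl

theorem star_scalarMatrix_mul_mul_apply {A : Type*} [NonUnitalCStarAlgebra A] (n : ℕ) (v : A)
    (M : CStarMatrix (Fin n) (Fin n) A) (p q : Fin n) :
    (star (scalarMatrix n v) * M * scalarMatrix n v) p q = star v * M p q * v := by
  simp [CStarMatrix.mul_apply, CStarMatrix.star_apply, scalarMatrix_apply, apply_ite star]

/-- Pass to the functional on matrices over B, extend that functional, and return; cutting down by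
the scalar matrix of `v` acts entrywise. -/
theorem exists_cp_extension {A B : Type*} [CStarAlgebra A] [NonUnitalCStarAlgebra B]
    (ι : B →⋆ₙₐ[ℂ] A) (hι : Function.Injective ι) {n : ℕ}
    {ψ : B →ₗ[ℂ] CStarMatrix (Fin n) (Fin n) ℂ} (hψ : IsCP ψ) (v : B) :
    ∃ Ψ : A →ₗ[ℂ] CStarMatrix (Fin n) (Fin n) ℂ, IsCP Ψ ∧
      ∀ x y, ι y = star (ι v) * x * ι v → Ψ x = ψ y := by
  let _ : PartialOrder A := CStarAlgebra.spectralOrder A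
  have : StarOrderedRing A := CStarAlgebra.spectralOrderedRing A
  let _ : PartialOrder B := CStarAlgebra.spectralOrder B
  have : StarOrderedRing B := CStarAlgebra.spectralOrderedRing B
  let J : CStarMatrix (Fin n) (Fin n) B →⋆ₙₐ[ℂ] CStarMatrix (Fin n) (Fin n) A :=
    CStarMatrix.mapₙₐ ι
  have hJ : Function.Injective J := fun M N h => by
    ext i j
    exact hι (CStarMatrix.ext_iff.mpr h i j)
  obtain ⟨G, hG, hGF⟩ := exists_positive_extension J hJ (toFunctional ψ)
    (toFunctional_nonneg hψ) (scalarMatrix n v)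
  refine ⟨ofFunctional G, isCP_ofFunctional G hG, fun x y hxy => ?_⟩
  ext i j
  rw [ofFunctional_apply, hGF (single i j x) (single i j y), toFunctional_single]
  ext p q
  have hd : J (scalarMatrix n v) =
      scalarMatrix n (ι v) := by
    ext p q
    change ι (scalarMatrix n v p q) = _
    rw [scalarMatrix_apply, scalarMatrix_apply, apply_ite ι, map_zero]
  rw [hd]
  rw [star_scalarMatrix_mul_mul_apply]
  change ι (single i j y p q) = _
  rw [single_apply, single_apply]
  split_ifs <;> simp [hxy]

/-! ### Corners of matrix algebras and factorable maps. -/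

section Rectangular

/-- The map `M ↦ Vᴴ * M * V` between matrix algebras of different sizes. -/
def conjRect {n N : ℕ} (V : Fin n → Fin N → ℂ) :
    CStarMatrix (Fin n) (Fin n) ℂ →ₗ[ℂ] CStarMatrix (Fin N) (Fin N) ℂ where
  toFun M := CStarMatrix.ofMatrix fun i j => ∑ p, ∑ q, star (V p i) * M p q * V q j
  map_add' M M' := by
    ext i j
    change ∑ p, ∑ q, star (V p i) * (M p q + M' p q) * V q j =
      ∑ p, ∑ q, star (V p i) * M p q * V q j + ∑ p, ∑ q, star (V p i) * M' p q * V q j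
    simp [mul_add, add_mul, Finset.sum_add_distrib]
  map_smul' z M := by
    ext i j
    change ∑ p, ∑ q, star (V p i) * (z * M p q) * V q j =
      z * ∑ p, ∑ q, star (V p i) * M p q * V q j
    simp_rw [Finset.mul_sum]
    exact Finset.sum_congr rfl fun p _ => Finset.sum_congr rfl fun q _ => by ring

theorem conjRect_apply {n N : ℕ} (V : Fin n → Fin N → ℂ) (M : CStarMatrix (Fin n) (Fin n) ℂ)
    (i j : Fin N) : conjRect V M i j = ∑ p, ∑ q, star (V p i) * M p q * V q j := rfl

theorem isCP_conjRect {n N : ℕ} (V : Fin n → Fin N → ℂ) : IsCP (conjRect V) := by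
  intro k a
  obtain _ | N := N
  · exact ⟨Empty, inferInstance, fun l => l.elim, fun i j => by ext p; exact p.elim0⟩
  refine ⟨Fin n, inferInstance, fun m i => rowMatrix 0 fun t => ∑ p, a i m p * V p t,
    fun i j => ?_⟩
  ext s t
  rw [cstarMatrix_sum_apply, conjRect_apply]
  simp_rw [star_rowMatrix_mul_apply, star_sum, Finset.sum_mul_sum, CStarMatrix.mul_apply,
    CStarMatrix.star_apply, Finset.mul_sum, Finset.sum_mul]
  rw [sum_sum_sum_rotate]
  refine Finset.sum_congr rfl fun m _ => Finset.sum_congr rfl fun p _ =>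
    Finset.sum_congr rfl fun q _ => ?_
  rw [star_mul]
  ring

theorem conjRect_transpose_comp {n N : ℕ} {e : Fin n → Fin N} (he : Function.Injective e)
    (M : CStarMatrix (Fin n) (Fin n) ℂ) :
    conjRect (fun i p => if e p = i then 1 else 0)
      (conjRect (fun p i => if e p = i then 1 else 0) M) = M := by
  ext i j
  simp [conjRect_apply, he.eq_iff]

theorem conjRect_transpose_comp_eq_zero {n m N : ℕ} {e : Fin n → Fin N} {e' : Fin m → Fin N}
    (he : ∀ i j, e i ≠ e' j) (M : CStarMatrix (Fin n) (Fin n) ℂ) :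
    conjRect (fun i p => if e' p = i then 1 else 0)
      (conjRect (fun p i => if e p = i then 1 else 0) M) = 0 := by
  ext i j
  simp [conjRect_apply, he]

end Rectangular

/-- A linear map that factors through a matrix algebra by completely positive maps. -/
def MatrixFactorable {A B : Type*} [NonUnitalCStarAlgebra A] [NonUnitalCStarAlgebra B]
    (T : A →ₗ[ℂ] B) : Prop :=
  ∃ (n : ℕ) (ψ : A →ₗ[ℂ] CStarMatrix (Fin n) (Fin n) ℂ)
    (φ : CStarMatrix (Fin n) (Fin n) ℂ →ₗ[ℂ] B), IsCP ψ ∧ IsCP φ ∧ T = φ ∘ₗ ψ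

section Factorable

variable {A B D : Type*} [NonUnitalCStarAlgebra A] [NonUnitalCStarAlgebra B]
  [NonUnitalCStarAlgebra D]

theorem MatrixFactorable.cp_comp {T : A →ₗ[ℂ] B} (hT : MatrixFactorable T) {f : B →ₗ[ℂ] D}
    (hf : IsCP f) : MatrixFactorable (f ∘ₗ T) := by
  obtain ⟨n, ψ, φ, hψ, hφ, rfl⟩ := hT
  exact ⟨n, ψ, f ∘ₗ φ, hψ, hf.comp hφ, rfl⟩

theorem MatrixFactorable.comp_cp {T : A →ₗ[ℂ] B} (hT : MatrixFactorable T) {f : D →ₗ[ℂ] A}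
    (hf : IsCP f) : MatrixFactorable (T ∘ₗ f) := by
  obtain ⟨n, ψ, φ, hψ, hφ, rfl⟩ := hT
  exact ⟨n, ψ ∘ₗ f, φ, hψ.comp hf, hφ, rfl⟩

/-- The two matrix algebras sit as orthogonal diagonal corners of size n and m in size n + m, so the
cross terms vanish. -/
theorem MatrixFactorable.add {T T' : A →ₗ[ℂ] B} (hT : MatrixFactorable T)
    (hT' : MatrixFactorable T') : MatrixFactorable (T + T') := by
  obtain ⟨n, ψ, φ, hψ, hφ, rfl⟩ := hT
  obtain ⟨m, ψ', φ', hψ', hφ', rfl⟩ := hT'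
  have hne (i : Fin n) (j : Fin m) : Fin.castAdd m i ≠ Fin.natAdd n j := by
    intro h
    have := congrArg Fin.val h
    simp at this
    omega
  refine ⟨n + m,
    conjRect (fun p i => if Fin.castAdd m p = i then 1 else 0) ∘ₗ ψ +
      conjRect (fun p i => if Fin.natAdd n p = i then 1 else 0) ∘ₗ ψ',
    φ ∘ₗ conjRect (fun i p => if Fin.castAdd m p = i then 1 else 0) +
      φ' ∘ₗ conjRect (fun i p => if Fin.natAdd n p = i then 1 else 0),
    ((isCP_conjRect _).comp hψ).add ((isCP_conjRect _).comp hψ'),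
    (hφ.comp (isCP_conjRect _)).add (hφ'.comp (isCP_conjRect _)), ?_⟩
  ext a
  simp only [LinearMap.add_apply, LinearMap.comp_apply, map_add]
  rw [conjRect_transpose_comp (Fin.castAdd_injective n m),
    conjRect_transpose_comp (Fin.natAdd_injective m n),
    conjRect_transpose_comp_eq_zero hne,
    conjRect_transpose_comp_eq_zero fun i j => (hne j i).symm]
  simp

end Factorable

/-! ### Making the factors contractive. -/

section Normalize

theorem norm_one_le_one (A : Type*) [CStarAlgebra A] : ‖(1 : A)‖ ≤ 1 := by
  obtain h | h := subsingleton_or_nontrivial A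
  · simp [Subsingleton.elim (1 : A) 0]
  · exact CStarRing.norm_one.le

/-- Take `t` to be the square root of `b + η` and `s` its inverse; then `star s * b * s ≤ star s *
(b + η) * s = 1`. The shift by η provides invertibility. -/
theorem exists_normalizer {F : Type*} [CStarAlgebra F] [PartialOrder F] [StarOrderedRing F]
    {b : F} (hb : 0 ≤ b) {η : ℝ} (hη : 0 < η) :
    ∃ t s : F, star t * t = b + algebraMap ℝ F η ∧ s * t = 1 ∧ ‖star s * b * s‖ ≤ 1 := by
  have h0 : 0 ≤ algebraMap ℝ F η := algebraMap_nonneg _ hη.le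
  have h1 : 0 ≤ b + algebraMap ℝ F η := add_nonneg hb h0
  have hu : IsUnit (b + algebraMap ℝ F η) :=
    CStarAlgebra.isUnit_of_le (algebraMap ℝ F η) (le_add_of_nonneg_left hb)
      ⟨h0, (IsUnit.mk0 η hη.ne').map (algebraMap ℝ F)⟩
  have hsq := CFC.sqrt_mul_sqrt_self (b + algebraMap ℝ F η) h1
  have hsa : star (CFC.sqrt (b + algebraMap ℝ F η)) = CFC.sqrt (b + algebraMap ℝ F η) :=
    (CFC.sqrt_nonneg _).isSelfAdjoint
  generalize CFC.sqrt (b + algebraMap ℝ F η) = t at hsq hsa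
  have ht : IsUnit t := by
    rw [← hsq, ← sq] at hu
    exact (isUnit_pow_iff two_ne_zero).mp hu
  obtain ⟨s, hs, hs'⟩ := isUnit_iff_exists.mp ht
  refine ⟨t, s, by rw [hsa, hsq], hs', ?_⟩
  have h2 : star s * (b + algebraMap ℝ F η) * s = 1 := by
    have h3 : star s * t = 1 := by rw [← hsa, ← star_mul, hs, star_one]
    rw [← hsq, ← mul_assoc, h3, one_mul, hs]
  rw [CStarAlgebra.norm_le_one_iff_of_nonneg _ (star_left_conjugate_nonneg hb s), ← h2]
  exact star_left_conjugate_le_conjugate (le_add_of_nonneg_right h0) s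

theorem isNuclear_of_matrixFactorable {A : Type u} [CStarAlgebra A]
    (h : ∀ (X : Finset A) (ε : ℝ), (∀ x ∈ X, ‖x‖ ≤ 1) → 0 < ε →
      ∃ T : A →ₗ[ℂ] A, MatrixFactorable T ∧ ∀ x ∈ X, ‖T x - x‖ ≤ ε) : IsNuclear A := by
  classical
  rw [isNuclear_iff]
  intro X ε hε
  let _ : PartialOrder A := CStarAlgebra.spectralOrder A
  have : StarOrderedRing A := CStarAlgebra.spectralOrderedRing A
  obtain ⟨R, hR, hXR⟩ : ∃ R : ℝ, 0 < R ∧ ∀ x ∈ X, ‖x‖ ≤ R := by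
    refine ⟨1 + ∑ x ∈ X, ‖x‖, by positivity, fun x hx => ?_⟩
    have := Finset.single_le_sum (f := fun x : A => ‖x‖) (fun _ _ => norm_nonneg _) hx
    linarith
  let δ : ℝ := ε / (4 * R)
  have hδ : 0 < δ := by positivity
  -- The unit is added to the finite set in order to control `‖φ (ψ 1)‖`.
  obtain ⟨_, ⟨n, ψ, φ, hψ, hφ, rfl⟩, hT⟩ := h
    (insert 1 (X.image fun x => ((R⁻¹ : ℝ) : ℂ) • x)) δ (by
      intro x hx
      rw [Finset.mem_insert, Finset.mem_image] at hx
      obtain rfl | ⟨x, hx, rfl⟩ := hx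
      · exact norm_one_le_one A
      · rw [norm_smul, Complex.norm_real, Real.norm_of_nonneg (by positivity)]
        exact inv_mul_le_one_of_le₀ (hXR x hx) hR.le) hδ
  have hX (x : A) (hx : x ∈ X) : ‖φ (ψ x) - x‖ ≤ R * δ := by
    have h1 := hT (((R⁻¹ : ℝ) : ℂ) • x)
      (Finset.mem_insert_of_mem (Finset.mem_image_of_mem _ hx))
    rw [map_smul, ← smul_sub, norm_smul, Complex.norm_real,
      Real.norm_of_nonneg (by positivity), inv_mul_le_iff₀ hR] at h1
    exact h1
  have h1 : ‖φ (ψ 1)‖ ≤ 1 + δ := by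
    have h2 := hT 1 (Finset.mem_insert_self _ _)
    have h3 := norm_le_norm_add_norm_sub' (φ (ψ 1)) 1
    have h4 := norm_one_le_one A
    rw [LinearMap.comp_apply] at h2
    linarith
  -- Chosen so that the shift costs at most δ after applying `φ`.
  let η : ℝ := δ / (‖φ 1‖ + 1)
  have hη : 0 < η := by positivity
  obtain ⟨t, s, ht, hts, hs⟩ := exists_normalizer (hψ.map_nonneg (zero_le_one (α := A))) hη
  have hφ0 : ‖φ (conjBy t 1)‖ ≤ 1 + 2 * δ := by
    have h2 : conjBy t 1 = ψ 1 + (η : ℂ) • 1 := by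
      rw [conjBy_apply, mul_one, ht, Algebra.algebraMap_eq_smul_one, Complex.coe_smul]
    have h3 : η * ‖φ 1‖ ≤ δ := by
      rw [div_mul_eq_mul_div, div_le_iff₀ (by positivity)]
      nlinarith [norm_nonneg (φ 1)]
    rw [h2, map_add, map_smul]
    refine (norm_add_le _ _).trans ?_
    rw [norm_smul, Complex.norm_real, Real.norm_of_nonneg hη.le]
    linarith
  have hψ' : IsCP (conjBy s ∘ₗ ψ) := (isCP_conjBy s).comp hψ
  have hφ' : IsCP (φ ∘ₗ conjBy t) := hφ.comp (isCP_conjBy t)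
  have hd : 0 < 1 + 2 * δ := by positivity
  refine ⟨n, conjBy s ∘ₗ ψ, (((1 + 2 * δ)⁻¹ : ℝ) : ℂ) • (φ ∘ₗ conjBy t), hψ',
    hφ'.smul (by positivity), fun a => ?_, fun m => ?_, fun x hx => ?_⟩
  · refine (hψ'.norm_apply_le a).trans ?_
    exact mul_le_of_le_one_left (norm_nonneg _) hs
  · rw [LinearMap.smul_apply, norm_smul, Complex.norm_real, Real.norm_of_nonneg (by positivity),
      inv_mul_le_iff₀ hd]
    refine (hφ'.norm_apply_le m).trans ?_
    gcongr
    exact hφ0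
  · have h2 : conjBy t (conjBy s (ψ x)) = ψ x := by
      rw [conjBy_apply, conjBy_apply, mul_assoc, mul_assoc, hts, mul_one, ← mul_assoc,
        ← star_mul, hts, star_one, one_mul]
    rw [LinearMap.smul_apply, LinearMap.comp_apply, LinearMap.comp_apply, h2]
    have h4 : (((1 + 2 * δ)⁻¹ : ℝ) : ℂ) • φ (ψ x) - x =
        (((1 + 2 * δ)⁻¹ : ℝ) : ℂ) • ((φ (ψ x) - x) - ((2 * δ : ℝ) : ℂ) • x) := by
      have h5 : (((1 + 2 * δ)⁻¹ : ℝ) : ℂ) * (1 + ((2 * δ : ℝ) : ℂ)) = 1 := by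
        rw [← Complex.ofReal_one, ← Complex.ofReal_add, ← Complex.ofReal_mul,
          inv_mul_cancel₀ hd.ne', Complex.ofReal_one]
      have h6 : x = (((1 + 2 * δ)⁻¹ : ℝ) : ℂ) • (x + ((2 * δ : ℝ) : ℂ) • x) := by
        rw [smul_add, smul_smul, ← add_smul, ← mul_one_add, h5, one_smul]
      nth_rw 2 [h6]
      rw [← smul_sub, sub_sub]
    rw [h4, norm_smul, Complex.norm_real, Real.norm_of_nonneg (by positivity),
      inv_mul_lt_iff₀ hd]
    have h7 : ‖((2 * δ : ℝ) : ℂ) • x‖ ≤ 2 * δ * R := by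
      rw [norm_smul, Complex.norm_real, Real.norm_of_nonneg (by positivity)]
      gcongr
      exact hXR x hx
    have h8 : R * δ = ε / 4 := by
      simp only [δ]
      field_simp
    have h9 := norm_sub_le (φ (ψ x) - x) (((2 * δ : ℝ) : ℂ) • x)
    -- The total error before division by `1 + 2δ` is at most `3Rδ = 3ε/4`.
    nlinarith [hX x hx]

end Normalize

/-! ### Factorable maps from nuclear subalgebras. -/

section ApproximateUnit

theorem exists_approximate_unit {A : Type*} [NonUnitalCStarAlgebra A] (X : Finset A) {ε : ℝ}
    (hε : 0 < ε) : ∃ u : A, ‖u‖ ≤ 1 ∧ ∀ x ∈ X, ‖conjBy u x - x‖ < ε := by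
  let _ : PartialOrder A := CStarAlgebra.spectralOrder A
  have : StarOrderedRing A := CStarAlgebra.spectralOrderedRing A
  have h := CStarAlgebra.increasingApproximateUnit A
  have h1 (x : A) : ∀ᶠ u in CStarAlgebra.approximateUnit A, ‖u * x - x‖ < ε / 2 := by
    have := Metric.tendsto_nhds.mp (h.tendsto_mul_right x) (ε / 2) (by positivity)
    simpa [dist_eq_norm] using this
  have h2 (x : A) : ∀ᶠ u in CStarAlgebra.approximateUnit A, ‖x * u - x‖ < ε / 2 := by
    have := Metric.tendsto_nhds.mp (h.tendsto_mul_left x) (ε / 2) (by positivity)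
    simpa [dist_eq_norm] using this
  have h3 := (Filter.eventually_all_finset X).mpr fun x _ => (h1 x).and (h2 x)
  obtain ⟨u, h4, hu, hu'⟩ := (h3.and (h.eventually_nonneg.and h.eventually_norm)).exists
  refine ⟨u, hu', fun x hx => ?_⟩
  obtain ⟨h5, h6⟩ := h4 x hx
  have h7 : conjBy u x - x = (u * x - x) * u + (x * u - x) := by
    rw [conjBy_apply, hu.isSelfAdjoint.star_eq]
    noncomm_ring
  rw [h7]
  refine (norm_add_le _ _).trans_lt ?_
  have h8 : ‖(u * x - x) * u‖ ≤ ‖u * x - x‖ :=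
    (norm_mul_le _ _).trans (mul_le_of_le_one_right (norm_nonneg _) hu')
  linarith

end ApproximateUnit

section Subalgebra

/-- If every element of a finite set is close to a nuclear C⋆-subalgebra, there is a completely
positive map factoring through a matrix algebra that nearly fixes these elements. -/
theorem exists_matrixFactorable_of_nuclear {A B : Type u} [CStarAlgebra A]
    [NonUnitalCStarAlgebra B] (ι : B →⋆ₙₐ[ℂ] A) (hι : Function.Injective ι) (hB : IsNuclear B)
    {δ : ℝ} (hδ : 0 < δ) (Y : Finset A) (hY : ∀ y ∈ Y, ∃ b, ‖y - ι b‖ ≤ δ) :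
    ∃ T : A →ₗ[ℂ] A, MatrixFactorable T ∧ ∀ y ∈ Y, ‖T y - y‖ ≤ 4 * δ := by
  classical
  choose! b hb using hY
  have hnorm := NonUnitalStarAlgHom.norm_map ι hι
  obtain ⟨u, hu, hub⟩ := exists_approximate_unit (Y.image b) hδ
  obtain ⟨n, ψ, φ, hψ, hφ, hψc, hφc, happ⟩ :=
    (isNuclear_iff B).mp hB ((Y.image b).image (conjBy u)) δ hδ
  obtain ⟨Ψ, hΨ, hΨψ⟩ := exists_cp_extension ι hι hψ u
  have hΨ1 : ‖Ψ 1‖ ≤ 1 := by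
    rw [hΨψ 1 (star u * u) (by simp [map_star])]
    refine (hψc _).trans ?_
    rw [CStarRing.norm_star_mul_self]
    exact mul_le_one₀ hu (norm_nonneg _) hu
  have hΨc (a : A) : ‖Ψ a‖ ≤ ‖a‖ :=
    (hΨ.norm_apply_le a).trans (mul_le_of_le_one_left (norm_nonneg _) hΨ1)
  refine ⟨(ι : B →ₗ[ℂ] A) ∘ₗ φ ∘ₗ Ψ, ⟨n, Ψ, (ι : B →ₗ[ℂ] A) ∘ₗ φ, hΨ,
    (isCP_of_starHom ι).comp hφ, rfl⟩, fun y hy => ?_⟩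
  have hby := Finset.mem_image_of_mem b hy
  have h1 : Ψ (ι (b y)) = ψ (conjBy u (b y)) := hΨψ _ _ (by simp [map_star])
  have h2 : ‖ι (φ (Ψ (y - ι (b y))))‖ ≤ δ := by
    rw [hnorm]
    exact (hφc _).trans ((hΨc _).trans (hb y hy))
  have h3 : ‖ι (φ (Ψ (ι (b y))) - conjBy u (b y))‖ ≤ δ := by
    rw [hnorm, h1]
    exact (happ _ (Finset.mem_image_of_mem _ hby)).le
  have h4 : ‖ι (conjBy u (b y) - b y)‖ ≤ δ := by
    rw [hnorm]
    exact (hub _ hby).le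
  -- Four errors of size δ: replacing `y` by `b y` twice, the matrix approximation, and the
  -- approximate unit.
  have h5 : ι (φ (Ψ y)) - y = ι (φ (Ψ (y - ι (b y)))) +
      ι (φ (Ψ (ι (b y))) - conjBy u (b y)) + ι (conjBy u (b y) - b y) - (y - ι (b y)) := by
    simp only [map_sub]
    abel
  change ‖ι (φ (Ψ y)) - y‖ ≤ _
  rw [h5]
  refine (norm_sub_le _ _).trans ?_
  have h6 := norm_add_le (ι (φ (Ψ (y - ι (b y)))) +
      ι (φ (Ψ (ι (b y))) - conjBy u (b y))) (ι (conjBy u (b y) - b y))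
  have h7 := norm_add_le (ι (φ (Ψ (y - ι (b y))))) (ι (φ (Ψ (ι (b y))) - conjBy u (b y)))
  linarith [hb y hy]

theorem exists_matrixFactorable_of_subalgebra {A : Type u} [CStarAlgebra A]
    {C : NonUnitalStarSubalgebra ℂ A}
    (hC : SubalgebraInClass (fun (B : Type u) [NonUnitalCStarAlgebra B] => IsNuclear B) C)
    {δ : ℝ} (hδ : 0 < δ) (Y : Finset A) (hY : ∀ y ∈ Y, ∃ c ∈ C, ‖y - c‖ ≤ δ) :
    ∃ T : A →ₗ[ℂ] A, MatrixFactorable T ∧ ∀ y ∈ Y, ‖T y - y‖ ≤ 4 * δ := by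
  obtain ⟨hclosed, hnuc⟩ := hC
  let _ : NonUnitalCStarAlgebra C :=
    NonUnitalStarSubalgebra.nonUnitalCStarAlgebra (h_closed := hclosed) C
  refine exists_matrixFactorable_of_nuclear (NonUnitalStarSubalgebraClass.subtype C)
    Subtype.val_injective hnuc hδ Y fun y hy => ?_
  obtain ⟨c, hc, h⟩ := hY y hy
  exact ⟨⟨c, hc⟩, h⟩

end Subalgebra

/-! ### Gluing the two pieces of a decomposition. -/

section Decomposition

theorem star_add_I_smul {A : Type*} [CStarAlgebra A] {h : A} (h0 : IsSelfAdjoint h) :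
    star (h + Complex.I • (1 - h)) = h - Complex.I • (1 - h) := by
  rw [star_add, star_smul, star_sub, star_one, h0.star_eq, Complex.star_def, Complex.conj_I,
    neg_smul, ← sub_eq_add_neg]

/-- The factor i makes the cross terms combine into a commutator, so a sum of two compressions
becomes almost a single conjugation. -/
theorem conjBy_add_I_smul {A : Type*} [CStarAlgebra A] {h : A} (h0 : IsSelfAdjoint h) (x : A) :
    conjBy (h + Complex.I • (1 - h)) x =
      h * x * h + (1 - h) * x * (1 - h) + Complex.I • (h * x - x * h) := by
  rw [conjBy_apply, star_add_I_smul h0]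
  have h1 : h * x - x * h = h * x * (1 - h) - (1 - h) * x * h := by noncomm_ring
  rw [h1]
  generalize 1 - h = k
  simp only [sub_mul, mul_add, smul_mul_assoc, mul_smul_comm, smul_sub, smul_smul,
    Complex.I_mul_I, neg_smul, one_smul]
  abel

/-- If `h` is self-adjoint then `h + i (1 - h)` has an inverse of norm at most `√2`. -/
theorem exists_inverse_of_isSelfAdjoint {A : Type*} [CStarAlgebra A] [PartialOrder A]
    [StarOrderedRing A] {h : A} (h0 : IsSelfAdjoint h) :
    ∃ c : A, (h + Complex.I • (1 - h)) * c = 1 ∧ ‖c‖ ^ 2 ≤ 2 := by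
  have hle : algebraMap ℝ A (1 / 2) ≤
      star (h + Complex.I • (1 - h)) * (h + Complex.I • (1 - h)) := by
    -- This is `h² + (1 - h)² - 1/2 = (2h - 1)²/2`.
    have h1 : star (h + Complex.I • (1 - h)) * (h + Complex.I • (1 - h)) - algebraMap ℝ A (1 / 2) =
        (1 / 2 : ℝ) • (star (2 * h - 1) * (2 * h - 1)) := by
      have h2 := conjBy_add_I_smul h0 1
      rw [conjBy_apply, mul_one, mul_one, mul_one, one_mul, sub_self, smul_zero,
        add_zero] at h2
      have h3 : star (2 * h - 1) = 2 * h - 1 := by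
        rw [two_mul, star_sub, star_add, star_one, h0.star_eq]
      have h4 : (2 * h - 1) * (2 * h - 1) = (2 : ℝ) • (h * h + (1 - h) * (1 - h)) - 1 := by
        rw [two_smul]
        noncomm_ring
      rw [h2, h3, h4, Algebra.algebraMap_eq_smul_one, smul_sub, smul_smul]
      norm_num
    rw [← sub_nonneg, h1]
    exact smul_nonneg (by norm_num) (star_mul_self_nonneg _)
  have hcomm : Commute (star (h + Complex.I • (1 - h))) (h + Complex.I • (1 - h)) := by
    have h1 : Commute h (Complex.I • (1 - h)) :=
      ((Commute.one_right h).sub_right (Commute.refl h)).smul_right _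
    rw [star_add_I_smul h0]
    exact ((Commute.refl h).sub_left h1.symm).add_right (h1.sub_left (Commute.refl _))
  generalize h + Complex.I • (1 - h) = w at *
  have hu : IsUnit (star w * w) := CStarAlgebra.isUnit_of_le (algebraMap ℝ A (1 / 2)) hle
      ⟨algebraMap_nonneg _ (by norm_num),
        (IsUnit.mk0 (1 / 2 : ℝ) (by norm_num)).map (algebraMap ℝ A)⟩
  obtain ⟨c, hc⟩ := (hcomm.isUnit_mul_iff.mp hu).2.exists_right_inv
  refine ⟨c, hc, ?_⟩
  have h1 := star_left_conjugate_le_conjugate hle c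
  have h2 : star c * (star w * w) * c = 1 := by
    rw [← mul_assoc, ← star_mul, hc, star_one, one_mul, hc]
  rw [h2] at h1
  have h3 : (1 / 2 : ℝ) • (star c * c) ≤ 1 := by
    convert h1 using 1
    rw [Algebra.algebraMap_eq_smul_one]
    simp
  have h4 : 0 ≤ (1 / 2 : ℝ) • (star c * c) := smul_nonneg (by norm_num) (star_mul_self_nonneg _)
  rw [← CStarAlgebra.norm_le_one_iff_of_nonneg _ h4, norm_smul, CStarRing.norm_star_mul_self] at h3
  norm_num at h3
  nlinarith

/-- Up to the commutator, `k * x * k` is `k * (k * x)`, which is close to `c * d`. Only the product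
has to lie in C, so `c` may involve the unit of A. -/
theorem exists_approx_mul_mul_self {A : Type*} [CStarAlgebra A] {C : NonUnitalStarSubalgebra ℂ A}
    {k x c d : A} {δ : ℝ} (hδ : δ ≤ 1) (hk : ‖k‖ ≤ 1) (hcd : c * d ∈ C)
    (hc : ‖k - c‖ ≤ δ) (hd : ‖k * x - d‖ ≤ δ) (hx : ‖x‖ ≤ 1)
    (hcomm : ‖k * x - x * k‖ ≤ δ) : ∃ e ∈ C, ‖k * x * k - e‖ ≤ 4 * δ := by
  refine ⟨c * d, hcd, ?_⟩
  have h1 : k * x * k - c * d = k * (k * x - d) + (k - c) * d - k * (k * x - x * k) := by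
    noncomm_ring
  have hδ0 : 0 ≤ δ := (norm_nonneg _).trans hc
  have h2 : ‖d‖ ≤ 2 := by
    have h3 : ‖k * x‖ ≤ 1 := (norm_mul_le _ _).trans (mul_le_one₀ hk (norm_nonneg _) hx)
    have h4 := norm_sub_norm_le d (k * x)
    rw [norm_sub_rev] at h4
    linarith
  have h5 : ‖k * (k * x - d)‖ ≤ 1 * δ := (norm_mul_le _ _).trans (by gcongr)
  have h6 : ‖(k - c) * d‖ ≤ δ * 2 := (norm_mul_le _ _).trans (by gcongr)
  have h7 : ‖k * (k * x - x * k)‖ ≤ 1 * δ := (norm_mul_le _ _).trans (by gcongr)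
  rw [h1]
  refine (norm_sub_le _ _).trans ?_
  have h8 := norm_add_le (k * (k * x - d)) ((k - c) * d)
  linarith

theorem isNuclear_of_decomposesWithIdentity {A : Type u} [CStarAlgebra A]
    (hA : DecomposesWithIdentity
      (fun (B : Type u) [NonUnitalCStarAlgebra B] => IsNuclear B) A 1) : IsNuclear A := by
  classical
  let _ : PartialOrder A := CStarAlgebra.spectralOrder A
  have : StarOrderedRing A := CStarAlgebra.spectralOrderedRing A
  refine isNuclear_of_matrixFactorable fun X ε hX hε => ?_
  let δ : ℝ := min 1 (ε / 100)
  have hδ : 0 < δ := by positivity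
  have hδ1 : δ ≤ 1 := min_le_left _ _
  have hδε : δ ≤ ε / 100 := min_le_right _ _
  obtain ⟨C, D, E, hC, hD, -, h, hE, h0, h1, hcomm, happ, hECD⟩ := hA X hX δ hδ
  have hpos : 0 ≤ h := h0
  have hsa : IsSelfAdjoint h := hpos.isSelfAdjoint
  have hk1 : ‖1 - h‖ ≤ 1 := by
    have h2 : h ≤ 1 := (CStarAlgebra.norm_le_one_iff_of_nonneg h hpos).mp h1
    rw [CStarAlgebra.norm_le_one_iff_of_nonneg _ (sub_nonneg.mpr h2)]
    exact sub_le_self _ hpos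
  have hksa : star (1 - h) = 1 - h := by rw [star_sub, star_one, hsa.star_eq]
  obtain ⟨⟨c, hcC, hc⟩, ⟨d, hdD, hd⟩⟩ := hECD h hE h1
  obtain ⟨T₁, hT₁, hT₁X⟩ := exists_matrixFactorable_of_subalgebra hC (δ := 4 * δ)
    (by positivity) (X.image fun x => h * x * h) (by
      intro y hy
      obtain ⟨x, hx, rfl⟩ := Finset.mem_image.mp hy
      obtain ⟨⟨c', hc', hxc'⟩, -, -⟩ := happ x hx
      exact exists_approx_mul_mul_self hδ1 h1 (mul_mem hcC hc') hc.le hxc'.le (hX x hx)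
        (hcomm x hx).le)
  obtain ⟨T₂, hT₂, hT₂X⟩ := exists_matrixFactorable_of_subalgebra hD (δ := 4 * δ)
    (by positivity) (X.image fun x => (1 - h) * x * (1 - h)) (by
      intro y hy
      obtain ⟨x, hx, rfl⟩ := Finset.mem_image.mp hy
      obtain ⟨-, ⟨d', hd', hxd'⟩, -⟩ := happ x hx
      -- Although `1 - d` need not lie in D, the product `(1 - d) * d' = d' - d * d'` does.
      refine exists_approx_mul_mul_self (c := 1 - d) hδ1 hk1 ?_ ?_ hxd'.le (hX x hx) ?_
      · rw [sub_mul, one_mul]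
        exact sub_mem hd' (mul_mem hdD hd')
      · rw [sub_sub_sub_cancel_left, norm_sub_rev]
        exact hd.le
      · have h2 : (1 - h) * x - x * (1 - h) = -(h * x - x * h) := by noncomm_ring
        rw [h2, norm_neg]
        exact (hcomm x hx).le)
  obtain ⟨w, hw, hwn⟩ := exists_inverse_of_isSelfAdjoint hsa
  refine ⟨conjBy w ∘ₗ (T₁ ∘ₗ conjBy h + T₂ ∘ₗ conjBy (1 - h)),
    ((hT₁.comp_cp (isCP_conjBy h)).add (hT₂.comp_cp (isCP_conjBy (1 - h)))).cp_comp
      (isCP_conjBy w), fun x hx => ?_⟩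
  have h2 : x = conjBy w (conjBy (h + Complex.I • (1 - h)) x) := by
    rw [conjBy_apply, conjBy_apply, mul_assoc, mul_assoc, hw, mul_one, ← mul_assoc, ← star_mul,
      hw, star_one, one_mul]
  have h3 : (conjBy w ∘ₗ (T₁ ∘ₗ conjBy h + T₂ ∘ₗ conjBy (1 - h))) x - x =
      conjBy w ((T₁ (h * x * h) - h * x * h) + (T₂ ((1 - h) * x * (1 - h)) -
        (1 - h) * x * (1 - h)) - Complex.I • (h * x - x * h)) := by
    nth_rw 2 [h2]
    rw [conjBy_add_I_smul hsa, LinearMap.comp_apply, ← map_sub, LinearMap.add_apply,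
      LinearMap.comp_apply, LinearMap.comp_apply, conjBy_apply h, conjBy_apply (1 - h),
      hsa.star_eq, hksa]
    congr 1
    abel
  rw [h3]
  refine (norm_conjBy_apply_le _ _).trans ?_
  have h4 := hT₁X _ (Finset.mem_image_of_mem _ hx)
  have h5 := hT₂X _ (Finset.mem_image_of_mem _ hx)
  have h6 := (hcomm x hx).le
  have h7 := norm_sub_le ((T₁ (h * x * h) - h * x * h) + (T₂ ((1 - h) * x * (1 - h)) -
        (1 - h) * x * (1 - h))) (Complex.I • (h * x - x * h))
  have h8 := norm_add_le (T₁ (h * x * h) - h * x * h) (T₂ ((1 - h) * x * (1 - h)) -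
        (1 - h) * x * (1 - h))
  rw [norm_smul, Complex.norm_I, one_mul] at h7
  -- Each compression contributes `4 * 4δ` and the commutator δ; the factor 2 bounds `‖w‖²`.
  calc _ ≤ 2 * (33 * δ) := by
        gcongr
        linarith
    _ ≤ ε := by linarith

end Decomposition

/-! ### Descent from the unitization, and algebras with an identity. -/

section Ideal

/-- The compression `z ↦ star u * z * u` of the unitization of `A` by `u : A`, as a map to `A`. -/
noncomputable def cutDown {A : Type*} [NonUnitalCStarAlgebra A] (u : A) :
    Unitization ℂ A →ₗ[ℂ] A where
  toFun z := (conjBy (u : Unitization ℂ A) z).snd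
  map_add' x y := by rw [map_add, Unitization.snd_add]
  map_smul' c x := by rw [map_smul, Unitization.snd_smul]; rfl

theorem inr_snd_of_fst_eq_zero {A : Type*} [NonUnitalCStarAlgebra A] {z : Unitization ℂ A}
    (hz : z.fst = 0) : ((z.snd : A) : Unitization ℂ A) = z := by
  ext <;> simp [hz]

theorem inr_cutDown {A : Type*} [NonUnitalCStarAlgebra A] (u : A) (z : Unitization ℂ A) :
    ((cutDown u z : A) : Unitization ℂ A) = conjBy (u : Unitization ℂ A) z :=
  inr_snd_of_fst_eq_zero (by simp)

theorem isCP_cutDown {A : Type*} [NonUnitalCStarAlgebra A] (u : A) : IsCP (cutDown u) := by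
  intro k a
  refine ⟨Unit, inferInstance, fun _ i => (a i * (u : Unitization ℂ A)).snd, fun i j => ?_⟩
  apply Unitization.inr_injective (R := ℂ)
  have h (i : Fin k) : (((a i * (u : Unitization ℂ A)).snd : A) : Unitization ℂ A) = a i * u :=
    inr_snd_of_fst_eq_zero (by simp)
  rw [inr_cutDown, Fintype.sum_unique, Unitization.inr_mul, Unitization.inr_star, h, h]
  simp only [conjBy_apply, star_mul, mul_assoc]

/-- A is an ideal, so compression by an approximate unit element is a contractive completely
positive map from the unitization to A that almost fixes X; it is applied after `φ`, while `ψ` is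
restricted to A. -/
theorem isNuclear_of_unitization (A : Type u) [NonUnitalCStarAlgebra A]
    (hA : IsNuclear (Unitization ℂ A)) : IsNuclear A := by
  classical
  rw [isNuclear_iff] at hA ⊢
  intro X ε hε
  obtain ⟨u, hu, huX⟩ := exists_approximate_unit X (half_pos hε)
  obtain ⟨n, ψ, φ, hψ, hφ, hψc, hφc, happ⟩ :=
    hA (X.image fun x : A => (x : Unitization ℂ A)) (ε / 2) (half_pos hε)
  have hcut (z : Unitization ℂ A) : ‖cutDown u z‖ ≤ ‖z‖ := by
    rw [← Unitization.norm_inr (𝕜 := ℂ), inr_cutDown]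
    refine (norm_conjBy_apply_le _ _).trans ?_
    rw [Unitization.norm_inr]
    exact mul_le_of_le_one_left (norm_nonneg _) (pow_le_one₀ (norm_nonneg _) hu)
  refine ⟨n, ψ ∘ₗ (Unitization.inrNonUnitalStarAlgHom ℂ A : A →ₗ[ℂ] Unitization ℂ A),
    cutDown u ∘ₗ φ, hψ.comp (isCP_of_starHom _), (isCP_cutDown u).comp hφ, fun a => ?_,
    fun m => (hcut _).trans (hφc m), fun x hx => ?_⟩
  · refine (hψc _).trans ?_
    exact (Unitization.norm_inr (𝕜 := ℂ) (a := a)).le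
  · have h1 : cutDown u (x : Unitization ℂ A) = conjBy u x := by
      apply Unitization.inr_injective (R := ℂ)
      rw [inr_cutDown]
      simp
    have h2 : cutDown u (φ (ψ x)) - x = cutDown u (φ (ψ x) - x) + (conjBy u x - x) := by
      rw [map_sub, h1]
      abel
    change ‖cutDown u (φ (ψ x)) - x‖ < ε
    rw [h2]
    refine (norm_add_le _ _).trans_lt ?_
    have h3 := (hcut _).trans_lt (happ _ (Finset.mem_image_of_mem _ hx))
    linarith [huX x hx]

end Ideal

section Identity

/-- A C⋆-algebra with an identity element, as a unital C⋆-algebra. -/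
@[reducible]
noncomputable def cstarAlgebraOfIdentity {A : Type*} [NonUnitalCStarAlgebra A] {e : A}
    (he : IsIdentity e) : CStarAlgebra A :=
  let R : Ring A :=
    { ‹NonUnitalCStarAlgebra A› with
      one := e
      one_mul := fun a => (he a).1
      mul_one := fun a => (he a).2 }
  let S : Algebra ℂ A := Algebra.ofModule smul_mul_assoc mul_smul_comm
  { ‹NonUnitalCStarAlgebra A›, R, S with }

end Identity

end CStarDecomposition

theorem mainTheorem11 :
    CStarDecomposition.ClosedUnderDecomposability
      (fun (A : Type u) [NonUnitalCStarAlgebra A] => CStarDecomposition.IsNuclear A) := by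
  rintro A _ (⟨e, he, hA⟩ | ⟨-, hA⟩)
  -- The norm and operations are kept and `1` is `e` by definition, so `hA` applies as it stands.
  · let _ : CStarAlgebra A := CStarDecomposition.cstarAlgebraOfIdentity he
    exact CStarDecomposition.isNuclear_of_decomposesWithIdentity hA
  · exact CStarDecomposition.isNuclear_of_unitization A
      (CStarDecomposition.isNuclear_of_decomposesWithIdentity hA)
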